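/- Let $\{-1,1\}^n$ carry the uniform probability measure and let $\mathbf E$ denote the expectation with respect to it. Let $2\le Q<\infty$. A real Banach space $E$ has cotype $Q$ if there is a finite constant $C\ge 0$ such that, for every $m\ge 0$ and all $v_1,\dots,v_m\in E$, $$\Big(\sum_{i=1}^m\|v_i\|_E^Q\Big)^{1/Q}\le C\,\Big(\mathbf E_\varepsilon\Big\|\sum_{i=1}^m\varepsilon_i v_i\Big\|_E^Q\Big)^{1/Q},$$ where $\varepsilon$ is uniformly distributed on $\{-1,1\}^m$; the least such $C$ is the cotype constant $C(E)$ (for the given $Q$). For $f:\{-1,1\}^n\to E$ put $$D_if(x)=\tfrac12\big(f(x)-f(x_1,\dots,x_{i-1},-x_i,x_{i+1},\dots,x_n)\big),\qquad i=1,\dots,n.$$ **Theorem.** There is a universal constant $c_0>0$ such that the following holds. Let $E$ be a Banach space of cotype $Q$, $2\le Q<\infty$, with cotype constant $C(E)$, let $n\ge 0$, and let $f:\{-1,1\}^n\to E$ satisfy the Lipschitz condition $$\mathbf E_\delta\Big\|\sum_{i=1}^n\delta_i D_if(x)\Big\|_E^2\le 1\qquad\text{for all }x\in\{-1,1\}^n,$$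 where $\delta$ is uniformly distributed on $\{-1,1\}^n$. Then $$\mathbf E\,\exp\Big(\frac{1}{4e}\,\|f-\mathbf E f\|_E^2\Big)\le \exp\big(c_0\,C(E)^2Q^2\big).$$ In particular the constant $\frac1{4e}$ in the exponent depends neither on $Q$ nor on $C(E)$. -/

import Mathlib

noncomputable section

namespace HammingCube

/-- The Hamming cube `{-1, 1}^n`; the two-point set `{-1, 1}` is the group of units of `ℤ`. -/
abbrev Cube (n : ℕ) : Type := Fin n → ℤˣ

/-- The sign `x_i ∈ {-1, 1}` as a real number. -/
def coord {n : ℕ} (x : Cube n) (i : Fin n) : ℝ := ((x i : ℤ) : ℝ)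

/-- The point obtained from `x` by changing the sign of its `i`-th coordinate. -/
def flip {n : ℕ} (x : Cube n) (i : Fin n) : Cube n := Function.update x i (-x i)

/-- Integration with respect to the uniform probability measure on the cube. -/
def expect {n : ℕ} {F : Type*} [AddCommGroup F] [Module ℝ F] (g : Cube n → F) : F :=
  ((2 : ℝ) ^ n)⁻¹ • ∑ x : Cube n, g x

section

variable {E : Type*} [NormedAddCommGroup E] [NormedSpace ℝ E]

/-- The discrete partial derivative
`D_i f (x) = (f (x) - f (x_1, …, -x_i, …, x_n)) / 2`. -/
def partialD {n : ℕ} (f : Cube n → E) (i : Fin n) (x : Cube n) : E :=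
  (1 / 2 : ℝ) • (f x - f (flip x i))

/-- The squared gradient at `x`: the average over all signs `δ` of
`‖∑ i, δ_i D_i f (x)‖ ^ 2`. -/
def gradSq {n : ℕ} (f : Cube n → E) (x : Cube n) : ℝ :=
  expect fun δ : Cube n => ‖∑ i, coord δ i • partialD f i x‖ ^ 2

end

section

variable (E : Type*) [NormedAddCommGroup E] [NormedSpace ℝ E]

/-- `C` is admissible in the Rademacher cotype `Q` inequality
`(∑ ‖v_i‖ ^ Q) ^ (1 / Q) ≤ C (𝔼 ‖∑ ε_i v_i‖ ^ Q) ^ (1 / Q)`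
for all finite families of vectors of `E`. -/
def IsCotypeBound (Q C : ℝ) : Prop :=
  0 ≤ C ∧ ∀ (m : ℕ) (v : Fin m → E),
    (∑ i, ‖v i‖ ^ Q) ^ (1 / Q) ≤
      C * (expect fun ε : Cube m => ‖∑ i, coord ε i • v i‖ ^ Q) ^ (1 / Q)

/-- `E` has (Rademacher) cotype `Q`, where `2 ≤ Q < ∞`. -/
def HasCotype (Q : ℝ) : Prop :=
  2 ≤ Q ∧ ∃ C : ℝ, IsCotypeBound E Q C

/-- The cotype `Q` constant of `E`: the least admissible constant. -/
def cotypeConst (Q : ℝ) : ℝ :=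
  sInf {C : ℝ | IsCotypeBound E Q C}

/-- The infimum defining the cotype constant is attained. -/
theorem isCotypeBound_cotypeConst (Q : ℝ) (h : HasCotype E Q) :
    IsCotypeBound E Q (cotypeConst E Q) := by
  obtain ⟨_, C, hC⟩ := h
  have hcl : IsClosed {C : ℝ | IsCotypeBound E Q C} := by
    have hset : {C : ℝ | IsCotypeBound E Q C} = Set.Ici 0 ∩ ⋂ m : ℕ, ⋂ v : Fin m → E,
        {C : ℝ | (∑ i, ‖v i‖ ^ Q) ^ (1 / Q) ≤
          C * (expect fun ε : Cube m => ‖∑ i, coord ε i • v i‖ ^ Q) ^ (1 / Q)} := by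
      ext
      simp [IsCotypeBound]
    rw [hset]
    refine isClosed_Ici.inter (isClosed_iInter fun m => isClosed_iInter fun v => ?_)
    exact isClosed_le continuous_const (by fun_prop)
  exact hcl.csInf_mem ⟨C, hC⟩ ⟨0, fun _ h => h.1⟩

end

end HammingCube

end

/-! The deviation `Z = ‖f - 𝔼f‖` is concentrated at a scale independent of the geometry of `E`.
Cotype enters only through its mean, so it affects the right-hand side but not the exponent.

Concentration: a norming functional at `f x` shows that the positive parts of the discrete
derivatives of `Z` have square sum at most `gradSq f x ≤ 1` (`sum_posPart_partialD_norm_le`). A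
modified log-Sobolev inequality with one-sided gradient and Herbst's argument give `𝔼 exp(tZ) ≤
exp(t 𝔼Z + 2t²)` for `t ≥ 0` (`expect_exp_le`). Integrating against `exp(-e t²)` yields the exponent
`1/(4e)`; this works because `2 < e` (`expect_exp_sq_le`).

Mean: `𝔼Z ≤ 32 C Q` (`IsCotypeBound.expect_norm_sub_le`). Product measures with coordinate mean `u`
interpolate between the uniform law (`u = 0`) and a point mass (`u = 1`). The derivative in `u` is
controlled by Rademacher sums of the `D_i f` in which each term survives with probability `p = (1 -
u²)/2`, divided by `1 - u²`. That singularity is integrable once the sparse sums are `O(p^α)` with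
`α > 0` (`expect_norm_sub_expect_le`).

Cotype supplies this decay with `α = 1/(2q)`, `2q ≈ Q` (`IsCotypeBound.lazyWalk_norm_le`).
Distributing a sum of activity `p₀ = 16^{-q}` at random over `N` bins leaves sums of activity `p₀/N`
in the bins, and cotype bounds the sum of their `2q`-th moments by that of the whole. At activity
`16^{-q}` hypercontractivity bounds that moment by the second moment of the full sum, that is, by
`gradSq`. -/

noncomputable section

namespace HammingCube

/-! ### Averages over the discrete cube -/

section CubeSums

variable {F : Type*} [AddCommGroup F] [Module ℝ F] {n : ℕ}

theorem sum_units_int {F : Type*} [AddCommMonoid F] (g : ℤˣ → F) : ∑ s, g s = g 1 + g (-1) := by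
  have : (Finset.univ : Finset ℤˣ) = {1, -1} := by decide
  rw [this, Finset.sum_pair (by decide)]

theorem sum_cube_succ {F : Type*} [AddCommMonoid F] (g : Cube (n + 1) → F) :
    ∑ x, g x = ∑ x : Cube n, g (Fin.cons 1 x) + ∑ x : Cube n, g (Fin.cons (-1) x) := by
  rw [← (Fin.consEquiv (fun _ : Fin (n + 1) => ℤˣ)).sum_comp, Fintype.sum_prod_type,
    sum_units_int]
  rfl

theorem expect_succ (g : Cube (n + 1) → F) :
    expect g = (1 / 2 : ℝ) • (expect (fun x : Cube n => g (Fin.cons 1 x)) +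
      expect (fun x : Cube n => g (Fin.cons (-1) x))) := by
  simp only [expect, sum_cube_succ, ← smul_add, smul_smul]
  congr 1
  rw [pow_succ]
  field_simp

theorem expect_zero_dim (g : Cube 0 → F) : expect g = g default := by
  simp only [expect, Fintype.sum_unique, pow_zero, inv_one, one_smul]
  exact congrArg g (Subsingleton.elim _ _)

theorem expect_add (g h : Cube n → F) :
    expect (fun x => g x + h x) = expect g + expect h := by
  simp [expect, Finset.sum_add_distrib]

theorem expect_sub (g h : Cube n → F) :
    expect (fun x => g x - h x) = expect g - expect h := by
  simp [expect, Finset.sum_sub_distrib, smul_sub]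

theorem expect_const_mul (c : ℝ) (g : Cube n → ℝ) :
    expect (fun x => c * g x) = c * expect g := by
  simp only [expect, ← Finset.mul_sum, smul_eq_mul]
  ring

theorem expect_const (c : F) : expect (fun _ : Cube n => c) = c := by
  simp only [expect, Finset.sum_const, Finset.card_univ]
  rw [← Nat.cast_smul_eq_nsmul ℝ, smul_smul]
  simp

theorem expect_mono {g h : Cube n → ℝ} (H : ∀ x, g x ≤ h x) : expect g ≤ expect h := by
  simp only [expect, smul_eq_mul]
  gcongr
  exact H _

theorem expect_nonneg {g : Cube n → ℝ} (H : ∀ x, 0 ≤ g x) : 0 ≤ expect g := by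
  simpa [expect_const] using expect_mono (g := fun _ : Cube n => (0 : ℝ)) H

theorem expect_pos {g : Cube n → ℝ} (H : ∀ x, 0 < g x) : 0 < expect g := by
  simp only [expect, smul_eq_mul]
  exact mul_pos (by positivity) (Finset.sum_pos (fun x _ => H x) Finset.univ_nonempty)

theorem expect_sum {ι : Type*} (s : Finset ι) (g : ι → Cube n → F) :
    expect (fun x => ∑ i ∈ s, g i x) = ∑ i ∈ s, expect (g i) := by
  simp only [expect, ← Finset.smul_sum]
  rw [Finset.sum_comm]

theorem coord_cons_zero (s : ℤˣ) (x : Cube n) :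
    coord (Fin.cons s x : Cube (n + 1)) 0 = ((s : ℤ) : ℝ) := rfl

theorem coord_cons_succ (s : ℤˣ) (x : Cube n) (i : Fin n) :
    coord (Fin.cons s x : Cube (n + 1)) i.succ = coord x i := rfl

theorem flip_cons_zero (s : ℤˣ) (x : Cube n) :
    flip (Fin.cons s x : Cube (n + 1)) 0 = Fin.cons (-s) x := by
  simp [flip]

theorem flip_cons_succ (s : ℤˣ) (x : Cube n) (i : Fin n) :
    flip (Fin.cons s x : Cube (n + 1)) i.succ = Fin.cons s (flip x i) := by
  simp [flip]

theorem coord_eq (x : Cube n) (i : Fin n) : coord x i = 1 ∨ coord x i = -1 := by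
  rcases Int.units_eq_one_or (x i) with h | h <;> simp [coord, h]

theorem flip_flip (x : Cube n) (i : Fin n) : flip (flip x i) i = x := by
  simp [flip]

theorem sum_comp_flip {F : Type*} [AddCommMonoid F] (i : Fin n) (g : Cube n → F) :
    ∑ x, g (flip x i) = ∑ x, g x :=
  Equiv.sum_comp (Function.Involutive.toPerm (fun x : Cube n => flip x i) fun x => flip_flip x i) g

theorem expect_comp_flip (i : Fin n) (g : Cube n → F) :
    expect (fun x => g (flip x i)) = expect g := by
  simp only [expect, sum_comp_flip]

theorem expect_comp_mul_right (y : Cube n) (g : Cube n → F) :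
    expect (fun x => g (x * y)) = expect g := by
  simp only [expect]
  exact congrArg _ (Equiv.sum_comp (Equiv.mulRight y) g)

end CubeSums

/-! ### Sparse Rademacher sums: contraction, hypercontractivity, random bins -/

section LazyWalk

variable {E : Type*} [NormedAddCommGroup E]

/-- Averaging of `Φ` over one step of the lazy random walk that moves by `± v` with
probability `p`. -/
def lazyStep (p : ℝ) (v : E) (Φ : E → ℝ) (a : E) : ℝ :=
  (1 - p) * Φ a + p / 2 * (Φ (a + v) + Φ (a - v))

/-- Averaging of `Φ` over the lazy random walk with the steps `± v`, `v ∈ l`, each of which is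
made with probability `p`. -/
def lazyWalk (p : ℝ) (l : List E) (Φ : E → ℝ) : E → ℝ := l.foldr (lazyStep p) Φ

@[simp] theorem lazyWalk_nil (p : ℝ) (Φ : E → ℝ) : lazyWalk p [] Φ = Φ := rfl

@[simp] theorem lazyWalk_cons (p : ℝ) (v : E) (l : List E) (Φ : E → ℝ) :
    lazyWalk p (v :: l) Φ = lazyStep p v (lazyWalk p l Φ) := rfl

theorem lazyStep_mono {p : ℝ} (h0 : 0 ≤ p) (h1 : p ≤ 1) (v : E) {Φ Ψ : E → ℝ}
    (h : ∀ a, Φ a ≤ Ψ a) (a : E) : lazyStep p v Φ a ≤ lazyStep p v Ψ a := by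
  unfold lazyStep
  have := sub_nonneg.2 h1
  gcongr <;> apply h

theorem lazyStep_nonneg {p : ℝ} (h0 : 0 ≤ p) (h1 : p ≤ 1) (v : E) {Φ : E → ℝ}
    (h : ∀ a, 0 ≤ Φ a) (a : E) : 0 ≤ lazyStep p v Φ a := by
  have := lazyStep_mono h0 h1 v h a
  simpa [lazyStep] using this

theorem lazyWalk_nonneg {p : ℝ} (h0 : 0 ≤ p) (h1 : p ≤ 1) (l : List E) {Φ : E → ℝ}
    (h : ∀ a, 0 ≤ Φ a) (a : E) : 0 ≤ lazyWalk p l Φ a := by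
  induction l generalizing a with
  | nil => exact h a
  | cons v l ih => exact lazyStep_nonneg h0 h1 v ih a

theorem lazyStep_pow_le {p : ℝ} (h0 : 0 ≤ p) (h1 : p ≤ 1) (v : E) {Φ : E → ℝ}
    (h : ∀ a, 0 ≤ Φ a) (k : ℕ) (a : E) :
    lazyStep p v Φ a ^ k ≤ lazyStep p v (fun b => Φ b ^ k) a := by
  have := Real.pow_arith_mean_le_arith_mean_pow Finset.univ ![1 - p, p / 2, p / 2]
    ![Φ a, Φ (a + v), Φ (a - v)]
    (by intro i _; fin_cases i <;> simp <;> linarith)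
    (by simp [Fin.sum_univ_three]; ring)
    (by intro i _; fin_cases i <;> simp [h]) k
  simp only [Fin.sum_univ_three, Matrix.cons_val] at this
  unfold lazyStep
  convert this using 1 <;> ring

theorem lazyWalk_pow_le {p : ℝ} (h0 : 0 ≤ p) (h1 : p ≤ 1) (l : List E) {Φ : E → ℝ}
    (h : ∀ a, 0 ≤ Φ a) (k : ℕ) (a : E) :
    lazyWalk p l Φ a ^ k ≤ lazyWalk p l (fun b => Φ b ^ k) a := by
  induction l generalizing a with
  | nil => exact le_rfl
  | cons v l ih =>
    exact (lazyStep_pow_le h0 h1 v (lazyWalk_nonneg h0 h1 l h) k a).trans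
      (lazyStep_mono h0 h1 v ih a)

variable [NormedSpace ℝ E]

theorem convexOn_lazyStep {p : ℝ} (h0 : 0 ≤ p) (h1 : p ≤ 1) (v : E) {Φ : E → ℝ}
    (h : ConvexOn ℝ Set.univ Φ) : ConvexOn ℝ Set.univ (lazyStep p v Φ) := by
  have hp : ConvexOn ℝ Set.univ fun a => Φ (a + v) := by
    simpa [Function.comp_def, add_comm] using h.translate_right v
  have hm : ConvexOn ℝ Set.univ fun a => Φ (a - v) := by
    simpa [Function.comp_def, sub_eq_neg_add] using h.translate_right (-v)
  exact (h.smul (sub_nonneg.2 h1)).add ((hp.add hm).smul (by positivity : 0 ≤ p / 2))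

theorem convexOn_lazyWalk {p : ℝ} (h0 : 0 ≤ p) (h1 : p ≤ 1) (l : List E) {Φ : E → ℝ}
    (h : ConvexOn ℝ Set.univ Φ) : ConvexOn ℝ Set.univ (lazyWalk p l Φ) := by
  induction l with
  | nil => exact h
  | cons v l ih => exact convexOn_lazyStep h0 h1 v ih

theorem two_mul_le_of_convexOn {Φ : E → ℝ} (h : ConvexOn ℝ Set.univ Φ) (a v : E) :
    2 * Φ a ≤ Φ (a + v) + Φ (a - v) := by
  have := h.2 (Set.mem_univ (a + v)) (Set.mem_univ (a - v)) 
    (by norm_num : (0 : ℝ) ≤ 1 / 2) (by norm_num : (0 : ℝ) ≤ 1 / 2) (by norm_num)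
  have e : (1 / 2 : ℝ) • (a + v) + (1 / 2 : ℝ) • (a - v) = a := by module
  rw [e] at this
  simp only [smul_eq_mul] at this
  linarith

/-- The contraction principle: averages of convex functions increase with the activity `p`. -/
theorem lazyWalk_mono_prob {p r : ℝ} (h0 : 0 ≤ p) (hpr : p ≤ r) (h1 : r ≤ 1) (l : List E)
    {Φ : E → ℝ} (h : ConvexOn ℝ Set.univ Φ) (a : E) : lazyWalk p l Φ a ≤ lazyWalk r l Φ a := by
  induction l generalizing a with
  | nil => exact le_rfl
  | cons v l ih =>
    refine (lazyStep_mono h0 (hpr.trans h1) v ih a).trans ?_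
    have := two_mul_le_of_convexOn (convexOn_lazyWalk (h0.trans hpr) h1 l h) a v
    simp only [lazyWalk_cons, lazyStep]
    nlinarith

/-- Averages over Rademacher sums are averages over the walk without laziness. -/
theorem expect_rademacher {n : ℕ} (v : Fin n → E) (Φ : E → ℝ) (a : E) :
    expect (fun ε : Cube n => Φ (a + ∑ i, coord ε i • v i)) =
      lazyWalk 1 (List.ofFn v) Φ a := by
  induction n generalizing a with
  | zero => simp [expect_zero_dim]
  | succ n ih =>
    rw [expect_succ, List.ofFn_succ, lazyWalk_cons, lazyStep, ← ih (a := a + v 0),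
      ← ih (a := a - v 0)]
    simp only [Fin.sum_univ_succ, coord_cons_zero, coord_cons_succ]
    simp [← add_assoc, sub_eq_add_neg]

/-- The two-point inequality behind the hypercontractivity of sparse Rademacher sums. -/
theorem mean_pow_sub_pow_mean_le {T e D : ℝ} (hT : 0 ≤ T) (hD : 0 ≤ D) (he : |e| ≤ T)
    (heD : e ^ 2 ≤ 4 * D * T) (q : ℕ) :
    ((T + e) ^ (q + 1) + (T - e) ^ (q + 1)) / 2 - T ^ (q + 1) ≤ 4 * 2 ^ (q + 1) * D * T ^ q := by
  obtain ⟨h1, h2⟩ := abs_le.1 he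
  have hX : ∀ k : ℕ, ((T + e) ^ k + (T - e) ^ k) / 2 ≤ 2 ^ k * T ^ k := by
    intro k
    have a1 : (T + e) ^ k ≤ (2 * T) ^ k := pow_le_pow_left₀ (by linarith) (by linarith) k
    have a2 : (T - e) ^ k ≤ (2 * T) ^ k := pow_le_pow_left₀ (by linarith) (by linarith) k
    rw [mul_pow] at a1 a2
    linarith
  have hY : ∀ k : ℕ, e * (((T + e) ^ k - (T - e) ^ k) / 2) ≤ 4 * 2 ^ k * D * T ^ k := by
    intro k
    induction k with
    | zero => simp [hD]
    | succ k ih =>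
      have a1 := mul_le_mul_of_nonneg_left ih hT
      have a2 := mul_le_mul heD (hX k)
        (by have := pow_nonneg (by linarith : 0 ≤ T + e) k
            have := pow_nonneg (by linarith : 0 ≤ T - e) k
            linarith) (by positivity)
      calc e * (((T + e) ^ (k + 1) - (T - e) ^ (k + 1)) / 2)
          = T * (e * (((T + e) ^ k - (T - e) ^ k) / 2))
            + e ^ 2 * (((T + e) ^ k + (T - e) ^ k) / 2) := by ring
        _ ≤ T * (4 * 2 ^ k * D * T ^ k) + 4 * D * T * (2 ^ k * T ^ k) := add_le_add a1 a2
        _ = _ := by ring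
  induction q with
  | zero => simp; positivity
  | succ q ih =>
    have a1 := mul_le_mul_of_nonneg_left ih hT
    have a2 := hY (q + 1)
    calc ((T + e) ^ (q + 1 + 1) + (T - e) ^ (q + 1 + 1)) / 2 - T ^ (q + 1 + 1)
        = T * (((T + e) ^ (q + 1) + (T - e) ^ (q + 1)) / 2 - T ^ (q + 1))
          + e * (((T + e) ^ (q + 1) - (T - e) ^ (q + 1)) / 2) := by ring
      _ ≤ T * (4 * 2 ^ (q + 1) * D * T ^ q) + 4 * 2 ^ (q + 1) * D * T ^ (q + 1) :=
          add_le_add a1 a2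
      _ = _ := by ring

/-- With `S = ((u+w)/2)²` and `D = ((u-w)/2)²`, the right side is `(S+D)^q` and `m^{2q} ≤ S^q`. For
`q ≥ 1`, the Jensen gap of the `q`-th power at `u²`, `w²` is at most `4·2^q D (S+D)^{q-1}`, while
`(S+D)^q - S^q ≥ D (S+D)^{q-1}`. A factor `p ≤ 16^{-q}` therefore absorbs the gap, since `1 + 4·2^q
≤ 16^q`. -/
theorem sparse_two_point {u w m p : ℝ} (hm : 0 ≤ m)
    (hmuw : 2 * m ≤ u + w) (hp : 0 ≤ p) {q : ℕ} (hpq : p * 16 ^ q ≤ 1) :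
    (1 - p) * m ^ (2 * q) + p / 2 * (u ^ (2 * q) + w ^ (2 * q)) ≤ ((u ^ 2 + w ^ 2) / 2) ^ q := by
  rcases q with _ | q
  · simp; linarith
  set S : ℝ := ((u + w) / 2) ^ 2 with hS
  set D : ℝ := ((u - w) / 2) ^ 2 with hD
  have hT : (u ^ 2 + w ^ 2) / 2 = S + D := by rw [hS, hD]; ring
  have hS0 : 0 ≤ S := sq_nonneg _
  have hD0 : 0 ≤ D := sq_nonneg _
  have hp1 : p ≤ 1 := by
    have : (1 : ℝ) ≤ 16 ^ (q + 1) := one_le_pow₀ (by norm_num)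
    nlinarith
  have hgap := mean_pow_sub_pow_mean_le (T := S + D) (e := (u ^ 2 - w ^ 2) / 2) (D := D)
    (by positivity) hD0 (by rw [← hT, abs_le]; constructor <;> nlinarith)
    (by rw [hS, hD]
        nlinarith [sq_nonneg ((u - w) * (u - w)), sq_nonneg ((u-w)/2)]) q
  have e1 : S + D + (u ^ 2 - w ^ 2) / 2 = u ^ 2 := by rw [← hT]; ring
  have e2 : S + D - (u ^ 2 - w ^ 2) / 2 = w ^ 2 := by rw [← hT]; ring
  rw [e1, e2, ← pow_mul, ← pow_mul] at hgap
  have hm' : m ^ (2 * (q + 1)) ≤ S ^ (q + 1) := by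
    rw [pow_mul]
    exact pow_le_pow_left₀ (sq_nonneg m)
      (pow_le_pow_left₀ hm (by linarith) 2) _
  have hST : S ^ (q + 1) + D * (S + D) ^ q ≤ (S + D) ^ (q + 1) := by
    have : S ^ q ≤ (S + D) ^ q := pow_le_pow_left₀ hS0 (by linarith) q
    nlinarith [pow_succ S q, pow_succ (S + D) q]
  have hpow : (1 : ℝ) + 4 * 2 ^ (q + 1) ≤ 16 ^ (q + 1) := by
    have h8 : (8 : ℝ) ≤ 8 ^ (q + 1) := by
      simpa using pow_le_pow_right₀ (by norm_num : (1 : ℝ) ≤ 8) (by omega : 1 ≤ q + 1)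
    have h2 : (2 : ℝ) ≤ 2 ^ (q + 1) := by
      simpa using pow_le_pow_right₀ (by norm_num : (1 : ℝ) ≤ 2) (by omega : 1 ≤ q + 1)
    have : (16 : ℝ) ^ (q + 1) = 2 ^ (q + 1) * 8 ^ (q + 1) := by rw [← mul_pow]; norm_num
    rw [this]
    nlinarith
  rw [hT]
  have hDT : 0 ≤ D * (S + D) ^ q := by positivity
  have k1 := mul_le_mul_of_nonneg_left hm' (sub_nonneg.2 hp1)
  have k2 := mul_le_mul_of_nonneg_left hgap hp
  have k3 : p * (1 + 4 * 2 ^ (q + 1)) ≤ 1 := (mul_le_mul_of_nonneg_left hpow hp).trans hpq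
  set X := (S + D) ^ (q + 1)
  set K := (4 : ℝ) * 2 ^ (q + 1)
  have k4 : p * (K * D * (S + D) ^ q) ≤ p * (K * (X - S ^ (q + 1))) := by
    have : K * D * (S + D) ^ q ≤ K * (X - S ^ (q + 1)) := by
      rw [mul_assoc]
      have : 0 ≤ K := by positivity
      gcongr
      linarith
    gcongr
  have k5 : p * (1 + K) * (X - S ^ (q + 1)) ≤ 1 * (X - S ^ (q + 1)) := by
    gcongr
    linarith
  linarith

/-- Minkowski's inequality in the Euclidean plane; the inductive step of `two_mul_sqrt_lazyWalk_le`.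
-/
theorem two_mul_sqrt_mean_sq_le {A B x y z w : ℝ} (hA : 0 ≤ A) (hB : 0 ≤ B)
    (h1 : 2 * A ≤ x + y) (h2 : 2 * B ≤ z + w) :
    2 * √((A ^ 2 + B ^ 2) / 2) ≤ √((x ^ 2 + z ^ 2) / 2) + √((y ^ 2 + w ^ 2) / 2) := by
  have hP := Real.sq_sqrt (by positivity : 0 ≤ (x ^ 2 + z ^ 2) / 2)
  have hR := Real.sq_sqrt (by positivity : 0 ≤ (y ^ 2 + w ^ 2) / 2)
  have hPR : (x * y + z * w) / 2 ≤ √((x ^ 2 + z ^ 2) / 2) * √((y ^ 2 + w ^ 2) / 2) := by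
    rw [← Real.sqrt_mul (by positivity)]
    refine Real.le_sqrt_of_sq_le ?_
    nlinarith [sq_nonneg (x * w - z * y)]
  have hS := Real.sq_sqrt (by positivity : 0 ≤ (A ^ 2 + B ^ 2) / 2)
  refine le_of_sq_le_sq ?_ (by positivity)
  nlinarith [mul_self_le_mul_self (by positivity) h1, mul_self_le_mul_self (by positivity) h2]

/-- The root is the `L²` norm of `a` plus a Rademacher sum, hence midpoint convex in `a`. This
supplies the hypothesis `2m ≤ u + w` of `sparse_two_point`. -/
theorem two_mul_sqrt_lazyWalk_le (l : List E) (a d : E) :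
    2 * √(lazyWalk 1 l (fun b => ‖b‖ ^ 2) a) ≤
      √(lazyWalk 1 l (fun b => ‖b‖ ^ 2) (a + d)) + √(lazyWalk 1 l (fun b => ‖b‖ ^ 2) (a - d)) := by
  induction l generalizing a with
  | nil =>
    simp only [lazyWalk_nil, Real.sqrt_sq (norm_nonneg _)]
    have := norm_add_le (a + d) (a - d)
    have e : a + d + (a - d) = (2 : ℝ) • a := by module
    rw [e, norm_smul] at this
    simpa using this
  | cons v l ih =>
    set H := lazyWalk 1 l (fun b : E => ‖b‖ ^ 2) with hH
    have hH0 : ∀ b, 0 ≤ H b := lazyWalk_nonneg zero_le_one le_rfl l (fun b => by positivity)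
    have key : ∀ b, lazyStep 1 v H b = (√(H (b + v)) ^ 2 + √(H (b - v)) ^ 2) / 2 := by
      intro b
      simp only [Real.sq_sqrt (hH0 _), lazyStep]
      ring
    simp only [lazyWalk_cons, ← hH, key]
    have i1 := ih (a + v)
    have i2 := ih (a - v)
    rw [add_right_comm, ← sub_add_eq_add_sub] at i1
    rw [← add_sub_right_comm, sub_right_comm] at i2
    exact two_mul_sqrt_mean_sq_le (Real.sqrt_nonneg _) (Real.sqrt_nonneg _) i1 i2

/-- Hypercontractivity of sparse Rademacher sums: the high moments of a Rademacher sum in which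
few terms are kept are controlled by the second moment of the full sum. -/
theorem lazyWalk_hypercontractive {p : ℝ} (hp : 0 ≤ p) {q : ℕ} (hpq : p * 16 ^ q ≤ 1)
    (l : List E) (a : E) :
    lazyWalk p l (fun b => ‖b‖ ^ (2 * q)) a ≤ lazyWalk 1 l (fun b => ‖b‖ ^ 2) a ^ q := by
  have hp1 : p ≤ 1 := by
    have : (1 : ℝ) ≤ 16 ^ q := one_le_pow₀ (by norm_num)
    nlinarith
  induction l generalizing a with
  | nil => simp [pow_mul]
  | cons v l ih =>
    refine (lazyStep_mono hp hp1 v ih a).trans ?_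
    have := sparse_two_point (Real.sqrt_nonneg _)
      (two_mul_sqrt_lazyWalk_le l a v) hp hpq
    have hH0 : ∀ b, 0 ≤ lazyWalk 1 l (fun b : E => ‖b‖ ^ 2) b :=
      lazyWalk_nonneg zero_le_one le_rfl l (fun b => by positivity)
    simp only [pow_mul, Real.sq_sqrt (hH0 _)] at this
    refine this.trans_eq ?_
    simp only [lazyWalk_cons, lazyStep]
    ring

/-- A cotype-like inequality for `N` vectors is inherited by lazy walks: each step is
distributed at random over `N` bins. -/
theorem sum_lazyWalk_le {N : ℕ} (hN : 0 < N) {p : ℝ} (h0 : 0 ≤ p) (h1 : p ≤ 1) (A : ℝ)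
    {Φ Ψ : E → ℝ}
    (h : ∀ s : Fin N → E, ∑ k, Φ (s k) ≤
      A * expect fun r : Cube N => Ψ (∑ k, coord r k • s k)) (l : List E) (s : Fin N → E) :
    ∑ k, lazyWalk (p / N) l Φ (s k) ≤
      A * expect fun r : Cube N => lazyWalk p l Ψ (∑ k, coord r k • s k) := by
  induction l generalizing s with
  | nil => exact h s
  | cons v l ih =>
    simp only [lazyWalk_cons]
    set Φ' := lazyWalk (p / N) l Φ
    set Ψ' := lazyWalk p l Ψ
    have hN' : (0 : ℝ) < N := by exact_mod_cast hN
    -- Bin `j` receives the new step for exactly one of the `N` choices of `k`, so it moves with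
    -- probability `p / N`.
    have hsum : ∀ w : E, ∑ k, ∑ j, Φ' ((s + Pi.single k w : Fin N → E) j) =
        ∑ j, ((N - 1) * Φ' (s j) + Φ' (s j + w)) := by
      intro w
      rw [Finset.sum_comm]
      refine Finset.sum_congr rfl fun j _ => ?_
      rw [← Finset.add_sum_erase _ _ (Finset.mem_univ j)]
      rw [Finset.sum_congr rfl (g := fun _ => Φ' (s j))]
      · simp [Nat.cast_sub (Nat.one_le_iff_ne_zero.2 hN.ne')]
        ring
      · intro k hk
        simp [(Finset.ne_of_mem_erase hk).symm]
    have hcoord : ∀ (r : Cube N) (k : Fin N) (w : E), ∑ j, coord r j • (s + Pi.single k w : Fin N → E) j =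
        ∑ j, coord r j • s j + coord r k • w := by
      intro r k w
      simp only [Pi.add_apply, smul_add, Finset.sum_add_distrib]
      congr 1
      rw [Finset.sum_eq_single k] <;> simp +contextual
    have hL : ∑ k, lazyStep (p / N) v Φ' (s k) = (1 - p) * ∑ k, Φ' (s k) +
        p / (2 * N) * ∑ k : Fin N, (∑ j, Φ' ((s + Pi.single k v : Fin N → E) j) +
          ∑ j, Φ' ((s + Pi.single k (-v) : Fin N → E) j)) := by
      rw [Finset.sum_add_distrib, hsum, hsum, ← Finset.sum_add_distrib, Finset.mul_sum,
        Finset.mul_sum, ← Finset.sum_add_distrib]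
      refine Finset.sum_congr rfl fun j _ => ?_
      simp only [lazyStep, ← sub_eq_add_neg]
      field_simp
      ring
    have hR : (expect fun r : Cube N => lazyStep p v Ψ' (∑ k, coord r k • s k)) =
        (1 - p) * (expect fun r : Cube N => Ψ' (∑ k, coord r k • s k)) +
        p / (2 * N) * ∑ k : Fin N,
          ((expect fun r : Cube N => Ψ' (∑ j, coord r j • (s + Pi.single k v : Fin N → E) j)) +
          expect fun r : Cube N => Ψ' (∑ j, coord r j • (s + Pi.single k (-v) : Fin N → E) j)) := by
      simp only [← expect_add, ← expect_sum, ← expect_const_mul]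
      congr 1
      ext r
      -- The bin's sign `r k` only exchanges the equally likely steps `v` and `-v`, so the signed
      -- total moves with probability `p` whichever bin is chosen.
      have : ∀ k, Ψ' (∑ j, coord r j • (s + Pi.single k v : Fin N → E) j) +
          Ψ' (∑ j, coord r j • (s + Pi.single k (-v) : Fin N → E) j) =
          Ψ' (∑ j, coord r j • s j + v) + Ψ' (∑ j, coord r j • s j - v) := by
        intro k
        rw [hcoord, hcoord]
        rcases coord_eq r k with e | e <;> simp [e, sub_eq_add_neg, add_comm]
      simp only [this, Finset.sum_const, Finset.card_univ, Fintype.card_fin, nsmul_eq_mul, lazyStep]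
      field_simp
    rw [hL, hR, mul_add, mul_left_comm, mul_left_comm A]
    refine add_le_add (mul_le_mul_of_nonneg_left (ih s) (sub_nonneg.2 h1))
      (mul_le_mul_of_nonneg_left ?_ (by positivity))
    rw [Finset.mul_sum]
    refine Finset.sum_le_sum fun k _ => ?_
    rw [mul_add]
    exact add_le_add (ih _) (ih _)

end LazyWalk

/-! ### Cotype and the decay of sparse sums -/

section Cotype

variable {E : Type*} [NormedAddCommGroup E] [NormedSpace ℝ E]

theorem expect_eq_sum_weights {n : ℕ} (g : Cube n → ℝ) :
    expect g = ∑ x, ((2 : ℝ) ^ n)⁻¹ * g x := by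
  simp [expect, Finset.mul_sum]

/-- Cotype `Q` with constant `C` implies cotype `k` with the same constant for all `k ≥ Q`. -/
theorem IsCotypeBound.sum_pow_le {Q C : ℝ} (hC : IsCotypeBound E Q C) (hQ : 0 < Q) {k : ℕ}
    (hk : Q ≤ k) {m : ℕ} (v : Fin m → E) :
    ∑ i, ‖v i‖ ^ k ≤ C ^ k * expect fun ε : Cube m => ‖∑ i, coord ε i • v i‖ ^ k := by
  obtain ⟨hC0, hC⟩ := hC
  set Y : Cube m → ℝ := fun ε => ‖∑ i, coord ε i • v i‖ with hY
  have hY0 : ∀ ε, 0 ≤ Y ε := fun ε => norm_nonneg _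
  have hk0 : (0 : ℝ) < k := hQ.trans_le hk
  have hkne : k ≠ 0 := by rintro rfl; simp at hk0
  -- Monotonicity of moments gives `∑ ‖v i‖^Q ≤ M^Q`; then each `‖v i‖ ≤ M`, and the surplus power
  -- `k - Q` costs a factor `M^(k - Q)`.
  set M : ℝ := C * (expect fun ε => Y ε ^ k) ^ (1 / (k : ℝ)) with hM
  have hEk : 0 ≤ expect fun ε => Y ε ^ k := expect_nonneg fun ε => pow_nonneg (hY0 ε) k
  have hM0 : 0 ≤ M := mul_nonneg hC0 (Real.rpow_nonneg hEk _)
  have hMk : M ^ k = C ^ k * expect fun ε => Y ε ^ k := by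
    rw [hM, mul_pow, one_div, Real.rpow_inv_natCast_pow hEk hkne]
  have hmom : (expect fun ε => Y ε ^ Q) ^ (1 / Q) ≤ (expect fun ε => Y ε ^ k) ^ (1 / (k : ℝ)) := by
    have := Real.rpow_arith_mean_le_arith_mean_rpow Finset.univ
      (fun _ : Cube m => ((2 : ℝ) ^ m)⁻¹) (fun ε => Y ε ^ Q) (fun _ _ => by positivity)
      (by simp) (fun ε _ => Real.rpow_nonneg (hY0 ε) _)
      (p := k / Q) ((one_le_div hQ).2 hk)
    rw [← expect_eq_sum_weights] at this
    have e : ∀ ε, (Y ε ^ Q) ^ ((k : ℝ) / Q) = Y ε ^ k := by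
      intro ε
      rw [← Real.rpow_mul (hY0 ε), mul_div_cancel₀ _ hQ.ne', Real.rpow_natCast]
    simp only [e] at this
    rw [← expect_eq_sum_weights] at this
    have hEQ : 0 ≤ expect fun ε => Y ε ^ Q := expect_nonneg fun ε => Real.rpow_nonneg (hY0 ε) Q
    have h2 := Real.rpow_le_rpow (Real.rpow_nonneg hEQ _) this (by positivity : 0 ≤ 1 / (k : ℝ))
    rw [← Real.rpow_mul hEQ] at h2
    convert h2 using 2
    field_simp
  have hsum : ∑ i, ‖v i‖ ^ Q ≤ M ^ Q := by
    have h := (hC m v).trans (mul_le_mul_of_nonneg_left hmom hC0)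
    have h0 : 0 ≤ ∑ i, ‖v i‖ ^ Q := Finset.sum_nonneg fun i _ => Real.rpow_nonneg (norm_nonneg _) _
    have := Real.rpow_le_rpow (Real.rpow_nonneg h0 _) h hQ.le
    rwa [← Real.rpow_mul h0, one_div_mul_cancel hQ.ne', Real.rpow_one] at this
  have hone : ∀ i, ‖v i‖ ≤ M := by
    intro i
    have : ‖v i‖ ^ Q ≤ M ^ Q := (Finset.single_le_sum (f := fun i => ‖v i‖ ^ Q)
      (fun i _ => Real.rpow_nonneg (norm_nonneg _) _) (Finset.mem_univ i)).trans hsum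
    exact (Real.rpow_le_rpow_iff (norm_nonneg _) hM0 hQ).1 this
  have hsplit : ∀ t : ℝ, 0 ≤ t → t ^ k = t ^ Q * t ^ ((k : ℝ) - Q) := by
    intro t ht
    rw [← Real.rpow_add_of_nonneg ht hQ.le (by linarith), add_sub_cancel, Real.rpow_natCast]
  rw [← hMk]
  calc ∑ i, ‖v i‖ ^ k ≤ ∑ i, ‖v i‖ ^ Q * M ^ ((k : ℝ) - Q) := by
        refine Finset.sum_le_sum fun i _ => ?_
        rw [hsplit _ (norm_nonneg _)]
        have := sub_nonneg.2 hk
        gcongr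
        exact hone i
    _ ≤ M ^ Q * M ^ ((k : ℝ) - Q) := by
        rw [← Finset.sum_mul]
        gcongr
    _ = M ^ k := (hsplit _ hM0).symm

/-- Test the inequality on a single nonzero vector. -/
theorem IsCotypeBound.one_le [Nontrivial E] {Q C : ℝ} (hC : IsCotypeBound E Q C) :
    1 ≤ C := by
  obtain ⟨e, he⟩ := exists_ne (0 : E)
  have hpos := norm_pos_iff.2 he
  have h := hC.2 1 fun _ => e
  have e1 : ∀ ε : Cube 1, ‖coord ε 0 • e‖ = ‖e‖ := by
    intro ε
    rcases coord_eq ε 0 with h | h <;> simp [h]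
  simp only [Fin.sum_univ_one, e1, expect_const] at h
  have : 0 < (‖e‖ ^ Q) ^ (1 / Q) := by positivity
  exact le_of_mul_le_mul_right (by simpa using h) this

theorem convexOn_norm_pow (k : ℕ) : ConvexOn ℝ Set.univ fun b : E => ‖b‖ ^ k :=
  convexOn_univ_norm.pow (fun _ _ => norm_nonneg _) k

/-- In a space of cotype `2q`, sparse Rademacher sums are small in comparison with the full
Rademacher sum. -/
theorem IsCotypeBound.lazyWalk_norm_le {Q C : ℝ} (hC : IsCotypeBound E Q C) (hQ : 0 < Q)
    (hC1 : 1 ≤ C) {q : ℕ} (hq : Q ≤ (2 * q : ℕ)) {l : List E}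
    (hl : lazyWalk 1 l (fun b => ‖b‖ ^ 2) 0 ≤ 1) {p : ℝ} (hp : 0 < p) (hp1 : p ≤ 1) :
    lazyWalk p l (fun b => ‖b‖) 0 ≤ 8 * C * p ^ (1 / ((2 * q : ℕ) : ℝ)) := by
  have hq0 : 2 * q ≠ 0 := by
    intro h
    rw [h] at hq
    norm_num at hq
    linarith
  have hnn : ∀ b : E, 0 ≤ ‖b‖ := fun b => norm_nonneg b
  set p₀ : ℝ := (16 ^ q)⁻¹ with hp₀
  have hp₀0 : 0 < p₀ := by positivity
  have hp₀1 : p₀ ≤ 1 := inv_le_one_of_one_le₀ (one_le_pow₀ (by norm_num))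
  refine le_of_pow_le_pow_left₀ hq0 (by positivity) ?_
  have hroot : (8 * C * p ^ (1 / ((2 * q : ℕ) : ℝ))) ^ (2 * q) = (8 * C) ^ (2 * q) * p := by
    rw [mul_pow, one_div, Real.rpow_inv_natCast_pow hp.le hq0]
  have h64 : (8 : ℝ) ^ (2 * q) = 4 ^ q * 16 ^ q := by rw [pow_mul, ← mul_pow]; norm_num
  have h4 : (4 : ℝ) ≤ 4 ^ q := by
    simpa using pow_le_pow_right₀ (by norm_num : (1 : ℝ) ≤ 4) (by omega : 1 ≤ q)
  have hCq : 1 ≤ C ^ (2 * q) := one_le_pow₀ hC1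
  rw [hroot, mul_pow, h64]
  -- For `p ≥ 16^{-q}` the claimed bound is at least `1`, and contraction with Jensen suffices. Only
  -- smaller `p` needs cotype.
  rcases le_total p₀ p with h | h
  · have h1 : lazyWalk p l (fun b => ‖b‖) 0 ≤ 1 := by
      refine (lazyWalk_mono_prob hp.le hp1 le_rfl l convexOn_univ_norm 0).trans ?_
      refine le_of_pow_le_pow_left₀ two_ne_zero zero_le_one ?_
      rw [one_pow]
      exact (lazyWalk_pow_le zero_le_one le_rfl l hnn 2 0).trans hl
    refine (pow_le_one₀ (lazyWalk_nonneg hp.le hp1 l hnn 0) h1).trans ?_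
    have : 1 ≤ 16 ^ q * p := by
      rw [hp₀, inv_le_iff_one_le_mul₀ (by positivity)] at h
      linarith
    nlinarith [mul_le_mul (by linarith : (1:ℝ) ≤ 4 ^ q) hCq zero_le_one (by positivity)]
  -- The most bins for which the activity per bin is still at least `p`. Rounding down loses at most
  -- a factor `2`, absorbed by `64^q = 4^q · 16^q`.
  · set N : ℕ := ⌊p₀ / p⌋₊ with hN
    have hN1 : 1 ≤ N := Nat.le_floor (by simpa using (one_le_div hp).2 h)
    have hN0 : (0 : ℝ) < N := by exact_mod_cast hN1
    have hNle : p ≤ p₀ / N := by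
      rw [le_div_iff₀ hN0, mul_comm, ← le_div_iff₀ hp]
      exact Nat.floor_le (by positivity)
    have hNge : p₀ ≤ 2 * N * p := by
      have := Nat.lt_floor_add_one (p₀ / p)
      rw [← hN, div_lt_iff₀ hp] at this
      have : (1 : ℝ) ≤ N := by exact_mod_cast hN1
      nlinarith
    have hNp : p₀ / N ≤ 1 := (div_le_self hp₀0.le (by exact_mod_cast hN1)).trans hp₀1
    have hbins := sum_lazyWalk_le (E := E) (N := N) hN1 hp₀0.le hp₀1 (C ^ (2 * q))
      (Φ := fun b => ‖b‖ ^ (2 * q)) (Ψ := fun b => ‖b‖ ^ (2 * q))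
      (fun s => hC.sum_pow_le hQ hq s) l 0
    simp only [Pi.zero_apply, smul_zero, Finset.sum_const_zero, expect_const, Finset.sum_const,
      Finset.card_univ, Fintype.card_fin, nsmul_eq_mul] at hbins
    have hhyp : lazyWalk p₀ l (fun b => ‖b‖ ^ (2 * q)) 0 ≤ 1 :=
      (lazyWalk_hypercontractive hp₀0.le (by rw [hp₀, inv_mul_cancel₀ (by positivity)]) l 0).trans
        (pow_le_one₀ (lazyWalk_nonneg zero_le_one le_rfl l (fun b => by positivity) 0) hl)
    have h1 : lazyWalk p l (fun b => ‖b‖) 0 ^ (2 * q) ≤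
        lazyWalk (p₀ / N) l (fun b => ‖b‖ ^ (2 * q)) 0 :=
      (lazyWalk_pow_le hp.le hp1 l hnn _ 0).trans
        (lazyWalk_mono_prob hp.le hNle hNp l (convexOn_norm_pow _) 0)
    have h2 : N * lazyWalk p l (fun b => ‖b‖) 0 ^ (2 * q) ≤ C ^ (2 * q) :=
      calc _ ≤ _ := mul_le_mul_of_nonneg_left h1 hN0.le
        _ ≤ _ := hbins
        _ ≤ C ^ (2 * q) * 1 := by gcongr
        _ = _ := mul_one _
    have h3 : 1 ≤ 2 * N * (16 ^ q * p) := by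
      rw [hp₀, inv_le_iff_one_le_mul₀ (by positivity)] at hNge
      linarith
    refine le_of_mul_le_mul_left (h2.trans ?_) hN0
    have h5 : 1 ≤ N * (4 ^ q * (16 ^ q * p)) := by
      have : 0 ≤ N * (16 ^ q * p) := by positivity
      nlinarith
    calc C ^ (2 * q) = 1 * C ^ (2 * q) := (one_mul _).symm
      _ ≤ N * (4 ^ q * (16 ^ q * p)) * C ^ (2 * q) := by gcongr
      _ = _ := by ring

end Cotype

/-! ### Interpolation by biased product measures -/

section Interpolation

variable {n : ℕ}

/-- The density of the law on the cube under which the coordinates are independent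
with mean `u`. -/
def biasedWeight (u : ℝ) (y : Cube n) : ℝ := ∏ i, (1 + u * coord y i) / 2

theorem biasedWeight_cons (u : ℝ) (s : ℤˣ) (y : Cube n) :
    biasedWeight u (Fin.cons s y : Cube (n + 1)) =
      (1 + u * ((s : ℤ) : ℝ)) / 2 * biasedWeight u y := by
  simp only [biasedWeight, Fin.prod_univ_succ, coord_cons_zero, coord_cons_succ]

theorem biasedWeight_nonneg {u : ℝ} (h0 : 0 ≤ u) (h1 : u ≤ 1) (y : Cube n) :
    0 ≤ biasedWeight u y := by
  refine Finset.prod_nonneg fun i _ => ?_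
  rcases coord_eq y i with h | h <;> rw [h] <;> linarith

theorem sum_biasedWeight_zero (c : Cube n → ℝ) : ∑ y, biasedWeight 0 y * c y = expect c := by
  simp [biasedWeight, expect, Finset.mul_sum]

theorem sum_biasedWeight_one (c : Cube n → ℝ) : ∑ y, biasedWeight 1 y * c y = c 1 := by
  rw [Finset.sum_eq_single 1]
  · simp [biasedWeight, coord]
  · intro y _ hy
    obtain ⟨i, hi⟩ := Function.ne_iff.1 hy
    have : coord y i = -1 := by
      rcases Int.units_eq_one_or (y i) with h | h
      · exact absurd h hi
      · simp [coord, h]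
    rw [biasedWeight, Finset.prod_eq_zero (Finset.mem_univ i) (by simp [this]), zero_mul]
  · simp

theorem coord_flip_self (y : Cube n) (i : Fin n) : coord (flip y i) i = -coord y i := by
  simp [coord, flip]

theorem coord_flip_of_ne (y : Cube n) {i j : Fin n} (h : j ≠ i) :
    coord (flip y i) j = coord y j := by
  simp [coord, flip, h]

theorem biasedWeight_eq_mul_prod_erase (u : ℝ) (y : Cube n) (i : Fin n) :
    biasedWeight u y =
      (1 + u * coord y i) / 2 * ∏ j ∈ Finset.univ.erase i, (1 + u * coord y j) / 2 :=
  (Finset.mul_prod_erase _ _ (Finset.mem_univ i)).symm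

theorem coord_mul_self (y : Cube n) (i : Fin n) : coord y i * coord y i = 1 := by
  rcases coord_eq y i with h | h <;> simp [h]

/-- Given the other coordinates, the `i`-th has mean `u` and `g` is constant; in terms of sums, the
summand is odd under the flip of coordinate `i`. -/
theorem sum_biasedWeight_mul_eq_zero (u : ℝ) (i : Fin n) {g : Cube n → ℝ}
    (hg : ∀ y, g (flip y i) = g y) : ∑ y, biasedWeight u y * ((coord y i - u) * g y) = 0 := by
  have h := sum_comp_flip i fun y => biasedWeight u y * ((coord y i - u) * g y)
  have e : ∀ y : Cube n, biasedWeight u (flip y i) * ((coord (flip y i) i - u) * g (flip y i)) =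
      -(biasedWeight u y * ((coord y i - u) * g y)) := by
    intro y
    rw [hg, biasedWeight_eq_mul_prod_erase u y i, biasedWeight_eq_mul_prod_erase u (flip y i) i,
      coord_flip_self, Finset.prod_congr rfl fun j hj => by
        rw [coord_flip_of_ne y (Finset.ne_of_mem_erase hj)]]
    have := coord_mul_self y i
    generalize coord y i = t at *
    linear_combination (u * g y * ∏ j ∈ Finset.univ.erase i, (1 + u * coord y j) / 2) * this
  simp only [e, Finset.sum_neg_distrib] at h
  linarith

/-- Logarithmic derivative of a product: for a sign `s`, `s / (1 + u s) = (s - u) / (1 - u²)`. -/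
theorem hasDerivAt_biasedWeight {u : ℝ} (hu : 1 - u ^ 2 ≠ 0) (y : Cube n) :
    HasDerivAt (fun t => biasedWeight t y)
      (∑ i, (1 - u ^ 2)⁻¹ * (biasedWeight u y * (coord y i - u))) u := by
  have hf : ∀ i ∈ Finset.univ, HasDerivAt (fun t : ℝ => (1 + t * coord y i) / 2)
      (coord y i / 2) u := by
    intro i _
    simpa using (((hasDerivAt_id u).mul_const (coord y i)).const_add 1).div_const 2
  have := HasDerivAt.fun_finsetProd hf
  refine this.congr_deriv (Finset.sum_congr rfl fun i _ => ?_)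
  rw [biasedWeight_eq_mul_prod_erase u y i, smul_eq_mul]
  have := coord_mul_self y i
  field_simp
  generalize coord y i = t at *
  linear_combination (-u * ∏ j ∈ Finset.univ.erase i, (1 + u * coord y j) / 2) * this

/-- The derivative of the interpolation between a function and its mean. -/
theorem hasDerivAt_sum_biasedWeight {u : ℝ} (hu : 1 - u ^ 2 ≠ 0) (c : Cube n → ℝ) :
    HasDerivAt (fun t => ∑ y, biasedWeight t y * c y)
      ((1 - u ^ 2)⁻¹ * ∑ y, biasedWeight u y *
        ∑ i, (coord y i - u) * ((c y - c (flip y i)) / 2)) u := by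
  have h := HasDerivAt.fun_sum (u := Finset.univ) fun y (_ : y ∈ Finset.univ) =>
    (hasDerivAt_biasedWeight hu y).mul_const (c y)
  refine h.congr_deriv ?_
  -- Split `c` into its odd and even parts in coordinate `i`; the even part contributes nothing.
  have e : ∑ y, ∑ i, biasedWeight u y * ((coord y i - u) * ((c y + c (flip y i)) / 2)) = 0 := by
    rw [Finset.sum_comm]
    refine Finset.sum_eq_zero fun i _ => ?_
    exact sum_biasedWeight_mul_eq_zero u i (g := fun y => (c y + c (flip y i)) / 2)
      fun y => by rw [flip_flip, add_comm]
  rw [← sub_eq_zero]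
  refine Eq.trans ?_ ((congrArg ((1 - u ^ 2)⁻¹ * ·) e).trans (mul_zero _))
  simp only [Finset.mul_sum, Finset.sum_mul, ← Finset.sum_sub_distrib]
  refine Finset.sum_congr rfl fun y _ => Finset.sum_congr rfl fun i _ => ?_
  ring

variable {E : Type*} [NormedAddCommGroup E] [NormedSpace ℝ E]

/-- Symmetrization of sums of independent centred biased signs. -/
theorem sum_biasedWeight_le_lazyWalk {u : ℝ} (h0 : 0 ≤ u) (h1 : u ≤ 1) {Φ : E → ℝ}
    (hΦ : ConvexOn ℝ Set.univ Φ) (v : Fin n → E) (a : E) :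
    ∑ y : Cube n, biasedWeight u y * Φ (a + ∑ i, ((coord y i - u) / 2) • v i) ≤
      lazyWalk ((1 - u ^ 2) / 2) (List.ofFn v) Φ a := by
  induction n generalizing a with
  | zero =>
    rw [Fintype.sum_unique]
    simp [biasedWeight]
  | succ n ih =>
    have hp0 : 0 ≤ (1 - u ^ 2) / 2 := by nlinarith
    have hp1 : (1 - u ^ 2) / 2 ≤ 1 := by nlinarith
    have hconv := convexOn_lazyWalk hp0 hp1 (List.ofFn fun i : Fin n => v i.succ) hΦ
    rw [List.ofFn_succ, lazyWalk_cons, sum_cube_succ]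
    simp only [Fin.sum_univ_succ, coord_cons_zero, coord_cons_succ, biasedWeight_cons, mul_assoc,
      ← Finset.mul_sum, ← add_assoc]
    set L := lazyWalk ((1 - u ^ 2) / 2) (List.ofFn fun i : Fin n => v i.succ) Φ with hL
    have i1 := ih (fun i => v i.succ) (a + (((((1 : ℤˣ) : ℤ) : ℝ) - u) / 2) • v 0)
    have i2 := ih (fun i => v i.succ) (a + (((((-1 : ℤˣ) : ℤ) : ℝ) - u) / 2) • v 0)
    -- Jensen over an independent copy `y'` of the biased sign `y`: `(y - u)/2` is the conditional
    -- mean of `(y - y')/2`, which is `±1` with probability `(1 - u²)/4` each and `0` otherwise.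
    have j1 := hconv.2 (Set.mem_univ a) (Set.mem_univ (a + v 0))
      (by linarith : 0 ≤ (1 + u) / 2) (by linarith : 0 ≤ (1 - u) / 2) (by ring)
    have j2 := hconv.2 (Set.mem_univ a) (Set.mem_univ (a - v 0))
      (by linarith : 0 ≤ (1 - u) / 2) (by linarith : 0 ≤ (1 + u) / 2) (by ring)
    have e1 : ((1 + u) / 2) • a + ((1 - u) / 2) • (a + v 0) =
        a + (((((1 : ℤˣ) : ℤ) : ℝ) - u) / 2) • v 0 := by
      push_cast
      module
    have e2 : ((1 - u) / 2) • a + ((1 + u) / 2) • (a - v 0) =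
        a + (((((-1 : ℤˣ) : ℤ) : ℝ) - u) / 2) • v 0 := by
      push_cast
      module
    rw [e1] at j1
    rw [e2] at j2
    simp only [smul_eq_mul] at j1 j2
    have k1 := mul_le_mul_of_nonneg_left (i1.trans j1) (by linarith : 0 ≤ (1 + u) / 2)
    have k2 := mul_le_mul_of_nonneg_left (i2.trans j2) (by linarith : 0 ≤ (1 - u) / 2)
    have s1 : (1 + u * ((((1 : ℤˣ) : ℤ) : ℝ))) / 2 = (1 + u) / 2 := by simp
    have s2 : (1 + u * ((((-1 : ℤˣ) : ℤ) : ℝ))) / 2 = (1 - u) / 2 := by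
      simp [sub_eq_add_neg]
    rw [s1, s2]
    refine (add_le_add k1 k2).trans_eq ?_
    simp only [lazyStep]
    ring

/-- If the sparse Rademacher sums of the discrete derivatives decay like a power of the
activity, then the function is close to its mean. -/
theorem expect_norm_sub_expect_le {f : Cube n → E} {K α : ℝ} (hK : 0 ≤ K) (hα0 : 0 < α)
    (hα1 : α ≤ 1)
    (h : ∀ z, ∀ p : ℝ, 0 < p → p ≤ 1 →
      lazyWalk p (List.ofFn fun i => partialD f i z) (fun b => ‖b‖) 0 ≤ K * p ^ α) :
    expect (fun x => ‖f x - expect f‖) ≤ 2 * K / α := by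
  choose ξ hξ1 hξ using fun x => exists_dual_vector'' ℝ (f x - expect f)
  -- Correlating the translates of `f` with the norming functionals `ξ x` makes the increment of `φ`
  -- over `[0, 1]` equal to `𝔼‖f - 𝔼f‖`.
  set c : Cube n → ℝ := fun y => expect fun x => ξ x (f (x * y)) with hc
  set φ : ℝ → ℝ := fun u => ∑ y, biasedWeight u y * c y with hφ
  have hφ1 : φ 1 = expect fun x => ξ x (f x) := by simp [hφ, sum_biasedWeight_one, hc]
  have hφ0 : φ 0 = expect fun x => ξ x (expect f) := by
    simp only [hφ, sum_biasedWeight_zero, hc]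
    have : ∀ x, ξ x (expect f) = expect fun y => ξ x (f (x * y)) := by
      intro x
      have e : expect f = expect fun y => f (x * y) := by
        simp only [expect]
        exact congrArg _ (Equiv.sum_comp (Equiv.mulLeft x) f).symm
      rw [e]
      simp [expect]
    simp only [this]
    simp only [expect, smul_eq_mul, Finset.mul_sum]
    rw [Finset.sum_comm]
  have hdiff : φ 1 - φ 0 = expect fun x => ‖f x - expect f‖ := by
    rw [hφ1, hφ0, ← expect_sub]
    congr 1
    ext x
    rw [← map_sub, hξ]
    rfl
  have hderiv : ∀ u ∈ Set.Ioo (0 : ℝ) 1, ∃ d, HasDerivAt φ d u ∧ d ≤ 2 * K * (1 - u) ^ (α - 1) := by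
    rintro u ⟨hu0, hu1⟩
    have hpos : 0 < 1 - u ^ 2 := by nlinarith
    refine ⟨_, hasDerivAt_sum_biasedWeight hpos.ne' c, ?_⟩
    have hterm : ∀ y : Cube n, ∑ i, (coord y i - u) * ((c y - c (flip y i)) / 2) ≤
        expect fun z => 2 * ‖∑ i, ((coord y i - u) / 2) • partialD f i z‖ := by
      intro y
      have e1 : ∑ i, (coord y i - u) * ((c y - c (flip y i)) / 2) =
          expect fun x => ξ x (∑ i, (coord y i - u) • partialD f i (x * y)) := by
        have hflip : ∀ (x : Cube n) i, x * flip y i = flip (x * y) i := by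
          intro x i
          ext j
          by_cases hj : j = i
          · subst hj; simp [flip]
          · simp [flip, hj]
        simp only [map_sum, map_smul, expect_sum, smul_eq_mul, expect_const_mul]
        refine Finset.sum_congr rfl fun i _ => ?_
        congr 1
        simp only [hc, ← expect_sub, partialD, map_smul, map_sub, smul_eq_mul, expect_const_mul,
          hflip]
        ring
      -- For fixed `y` the point `x * y` is uniform, so the base point `z` decouples from the biased
      -- signs.
      rw [e1, ← expect_comp_mul_right y fun z => 2 * ‖∑ i, ((coord y i - u) / 2) • partialD f i z‖]
      refine expect_mono fun x => ?_
      have e2 : ∑ i, (coord y i - u) • partialD f i (x * y) =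
          (2 : ℝ) • ∑ i, ((coord y i - u) / 2) • partialD f i (x * y) := by
        rw [Finset.smul_sum]
        refine Finset.sum_congr rfl fun i _ => ?_
        module
      refine (le_abs_self _).trans (((ξ x).le_of_opNorm_le (hξ1 x) _).trans_eq ?_)
      rw [e2, norm_smul]
      simp
    have hsum : ∑ y : Cube n, biasedWeight u y *
        ∑ i, (coord y i - u) * ((c y - c (flip y i)) / 2) ≤ 2 * (K * ((1 - u ^ 2) / 2) ^ α) := by
      calc _ ≤ ∑ y : Cube n, biasedWeight u y *
            expect fun z => 2 * ‖∑ i, ((coord y i - u) / 2) • partialD f i z‖ :=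
          Finset.sum_le_sum fun y _ =>
            mul_le_mul_of_nonneg_left (hterm y) (biasedWeight_nonneg hu0.le hu1.le y)
        _ = expect fun z => 2 * ∑ y : Cube n, biasedWeight u y *
              ‖0 + ∑ i, ((coord y i - u) / 2) • partialD f i z‖ := by
          simp only [← expect_const_mul, ← expect_sum, zero_add]
          congr 1
          ext z
          rw [Finset.mul_sum]
          exact Finset.sum_congr rfl fun y _ => by ring
        _ ≤ expect fun _ : Cube n => 2 * (K * ((1 - u ^ 2) / 2) ^ α) := by
          refine expect_mono fun z => mul_le_mul_of_nonneg_left ?_ zero_le_two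
          exact (sum_biasedWeight_le_lazyWalk hu0.le hu1.le convexOn_univ_norm _ 0).trans
            (h z _ (by linarith) (by nlinarith))
        _ = _ := expect_const _
    calc _ ≤ (1 - u ^ 2)⁻¹ * (2 * (K * ((1 - u ^ 2) / 2) ^ α)) :=
          mul_le_mul_of_nonneg_left hsum (by positivity)
      _ ≤ (1 - u ^ 2)⁻¹ * (2 * (K * (1 - u ^ 2) ^ α)) := by
          gcongr
          linarith
      _ = 2 * K * (1 - u ^ 2) ^ (α - 1) := by
          rw [Real.rpow_sub hpos, Real.rpow_one]
          ring
      _ ≤ 2 * K * (1 - u) ^ (α - 1) := by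
          refine mul_le_mul_of_nonneg_left ?_ (by positivity)
          exact Real.rpow_le_rpow_of_nonpos (by linarith) (by nlinarith) (by linarith)
  -- Integrated form of the derivative bound, avoiding an integral singular at `u = 1`.
  have hanti : AntitoneOn (fun u => φ u + 2 * K / α * (1 - u) ^ α) (Set.Icc 0 1) := by
    have hcont : Continuous φ := by
      simp only [hφ, biasedWeight]
      fun_prop
    have hder : ∀ u ∈ Set.Ioo (0 : ℝ) 1, ∃ d,
        HasDerivAt (fun u => φ u + 2 * K / α * (1 - u) ^ α) d u ∧ d ≤ 0 := by
      intro u hu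
      obtain ⟨d, hd, hle⟩ := hderiv u hu
      have hpow := (((hasDerivAt_id u).const_sub 1).rpow_const (p := α)
        (Or.inl (by simpa using (sub_pos.2 hu.2).ne'))).const_mul (2 * K / α)
      refine ⟨_, hd.add hpow, ?_⟩
      simp only [id]
      have : 2 * K / α * (-1 * α * (1 - u) ^ (α - 1)) = -(2 * K * (1 - u) ^ (α - 1)) := by
        field_simp
      linarith
    refine antitoneOn_of_deriv_nonpos (convex_Icc 0 1) ?_ ?_ ?_
    · refine hcont.continuousOn.add (continuousOn_const.mul ?_)
      exact ((continuous_const.sub continuous_id).rpow_const fun _ => Or.inr hα0.le).continuousOn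
    · rw [interior_Icc]
      intro u hu
      obtain ⟨d, hd, -⟩ := hder u hu
      exact hd.differentiableAt.differentiableWithinAt
    · rw [interior_Icc]
      intro u hu
      obtain ⟨d, hd, hle⟩ := hder u hu
      rwa [hd.deriv]
  have := hanti (Set.left_mem_Icc.2 zero_le_one) (Set.right_mem_Icc.2 zero_le_one) zero_le_one
  simp only [sub_self, sub_zero, Real.zero_rpow hα0.ne', Real.one_rpow] at this
  rw [← hdiff]
  linarith

end Interpolation

/-! ### Modified logarithmic Sobolev inequality and Herbst's argument -/

section Entropy

variable {n : ℕ}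

/-- The log-sum inequality, from `log r ≤ r - 1` with `r = b x 𝔼a / (a x 𝔼b)`. It passes from the
averages on two half-cubes to the pointwise edge terms. -/
theorem log_sum_le {a b : Cube n → ℝ} (ha : ∀ x, 0 < a x) (hb : ∀ x, 0 < b x) :
    expect a * (Real.log (expect a) - Real.log (expect b)) ≤
      expect fun x => a x * (Real.log (a x) - Real.log (b x)) := by
  have hA := expect_pos ha
  have hB := expect_pos hb
  have key : ∀ x, a x * (Real.log (expect a) - Real.log (expect b)) + a x -
      expect a / expect b * b x ≤ a x * (Real.log (a x) - Real.log (b x)) := by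
    intro x
    have hax := ha x
    have hbx := hb x
    have := Real.log_le_sub_one_of_pos (x := b x * expect a / (a x * expect b)) (by positivity)
    rw [Real.log_div (by positivity) (by positivity), Real.log_mul hbx.ne' hA.ne',
      Real.log_mul hax.ne' hB.ne'] at this
    have h2 := mul_le_mul_of_nonneg_left this hax.le
    have e : a x * (b x * expect a / (a x * expect b) - 1) = expect a / expect b * b x - a x := by
      field_simp
    rw [e] at h2
    linarith
  have := expect_mono key
  have e : (fun x => a x * (Real.log (expect a) - Real.log (expect b)) + a x -
      expect a / expect b * b x) = fun x =>
      ((Real.log (expect a) - Real.log (expect b)) * a x + a x) - expect a / expect b * b x := by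
    ext x
    ring
  rw [e, expect_sub, expect_add, expect_const_mul, expect_const_mul,
    div_mul_cancel₀ _ hB.ne'] at this
  linarith

theorem entropy_two_point_le {a b : ℝ} (ha : 0 < a) (hb : 0 < b) :
    (a * Real.log a + b * Real.log b) / 2 - (a + b) / 2 * Real.log ((a + b) / 2) ≤
      1 / 4 * ((a - b) * (Real.log a - Real.log b)) := by
  have h := strictConcaveOn_log_Ioi.concaveOn.2 (Set.mem_Ioi.2 ha) (Set.mem_Ioi.2 hb)
    (by norm_num : (0 : ℝ) ≤ 1 / 2) (by norm_num : (0 : ℝ) ≤ 1 / 2) (by norm_num)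
  simp only [smul_eq_mul] at h
  rw [show 1 / 2 * a + 1 / 2 * b = (a + b) / 2 by ring] at h
  have := mul_le_mul_of_nonneg_left h (by positivity : 0 ≤ (a + b) / 2)
  linarith

/-- Tensorization of the entropy on the cube. -/
theorem entropy_le {G : Cube n → ℝ} (hG : ∀ x, 0 < G x) :
    expect (fun x => G x * Real.log (G x)) - expect G * Real.log (expect G) ≤
      ∑ i, expect fun x =>
        1 / 4 * ((G x - G (flip x i)) * (Real.log (G x) - Real.log (G (flip x i)))) := by
  induction n with
  | zero => simp [expect_zero_dim]
  | succ n ih =>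
    set a : Cube n → ℝ := fun x => G (Fin.cons 1 x) with ha
    set b : Cube n → ℝ := fun x => G (Fin.cons (-1) x) with hb
    have ha0 : ∀ x, 0 < a x := fun x => hG _
    have hb0 : ∀ x, 0 < b x := fun x => hG _
    have i1 := ih ha0
    have i2 := ih hb0
    -- The entropy is the mean of the entropies on the two halves plus the two-point entropy of
    -- their averages. The latter becomes the edge term of the first coordinate through
    -- `log_sum_le`, used in both directions.
    have t := entropy_two_point_le (expect_pos ha0) (expect_pos hb0)
    have l1 := log_sum_le ha0 hb0
    have l2 := log_sum_le hb0 ha0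
    have hsplit : expect (fun x => 1 / 4 * ((a x - b x) * (Real.log (a x) - Real.log (b x)))) =
        1 / 4 * (expect (fun x => a x * (Real.log (a x) - Real.log (b x))) +
          expect fun x => b x * (Real.log (b x) - Real.log (a x))) := by
      rw [← expect_add, ← expect_const_mul]
      congr 1
      ext x
      ring
    have hsymm : expect (fun x => 1 / 4 * ((b x - a x) * (Real.log (b x) - Real.log (a x)))) =
        expect (fun x => 1 / 4 * ((a x - b x) * (Real.log (a x) - Real.log (b x)))) := by
      congr 1
      ext x
      ring
    rw [Fin.sum_univ_succ]
    simp only [expect_succ, flip_cons_zero, flip_cons_succ, neg_neg, smul_eq_mul]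
    simp only [← Finset.mul_sum, Finset.sum_add_distrib]
    change 1 / 2 * (expect (fun x => a x * Real.log (a x)) + expect fun x => b x * Real.log (b x)) -
      1 / 2 * (expect a + expect b) * Real.log (1 / 2 * (expect a + expect b)) ≤
      1 / 2 * (expect (fun x => 1 / 4 * ((a x - b x) * (Real.log (a x) - Real.log (b x)))) +
        expect (fun x => 1 / 4 * ((b x - a x) * (Real.log (b x) - Real.log (a x))))) +
      1 / 2 * (∑ i, expect (fun x =>
        1 / 4 * ((a x - a (flip x i)) * (Real.log (a x) - Real.log (a (flip x i))))) +
        ∑ i, expect fun x =>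
        1 / 4 * ((b x - b (flip x i)) * (Real.log (b x) - Real.log (b (flip x i)))))
    rw [hsymm, hsplit, show 1 / 2 * (expect a + expect b) = (expect a + expect b) / 2 by ring]
    linarith

/-- Weighting by the larger endpoint only is what allows a one-sided gradient. -/
theorem exp_sub_mul_le {s t : ℝ} (h : t ≤ s) :
    (Real.exp s - Real.exp t) * (s - t) ≤ Real.exp s * (s - t) ^ 2 := by
  have h1 : Real.exp s * (1 - (s - t)) ≤ Real.exp t := by
    have := Real.add_one_le_exp (t - s)
    calc Real.exp s * (1 - (s - t)) ≤ Real.exp s * Real.exp (t - s) := by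
          gcongr
          linarith
      _ = Real.exp t := by rw [← Real.exp_add]; congr 1; ring
  nlinarith

/-- The modified logarithmic Sobolev inequality with a one-sided gradient. -/
theorem entropy_exp_le {h : Cube n → ℝ} (hgrad : ∀ x, ∑ i, max (partialD h i x) 0 ^ 2 ≤ 1)
    {t : ℝ} (ht : 0 ≤ t) :
    expect (fun x => Real.exp (t * h x) * (t * h x)) -
      expect (fun x => Real.exp (t * h x)) * Real.log (expect fun x => Real.exp (t * h x)) ≤
      2 * t ^ 2 * expect fun x => Real.exp (t * h x) := by
  have hent := entropy_le (G := fun x => Real.exp (t * h x)) fun x => Real.exp_pos _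
  simp only [Real.log_exp] at hent
  refine hent.trans ?_
  -- Each edge is charged to its endpoint with the larger `h`. Summing over both endpoints, by flip
  -- invariance, produces the factor `2`.
  set T : Fin n → Cube n → ℝ := fun i x =>
    t ^ 2 * (Real.exp (t * h x) * max (partialD h i x) 0 ^ 2) with hT
  have hpt : ∀ i x, 1 / 4 * ((Real.exp (t * h x) - Real.exp (t * h (flip x i))) *
      (t * h x - t * h (flip x i))) ≤ T i x + T i (flip x i) := by
    have main : ∀ i x, h (flip x i) ≤ h x →
        1 / 4 * ((Real.exp (t * h x) - Real.exp (t * h (flip x i))) *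
          (t * h x - t * h (flip x i))) ≤ T i x := by
      intro i x hx
      have h1 := exp_sub_mul_le (mul_le_mul_of_nonneg_left hx ht)
      have h2 : max (partialD h i x) 0 = (h x - h (flip x i)) / 2 := by
        rw [max_eq_left] <;> simp only [partialD, smul_eq_mul] <;> linarith
      simp only [hT, h2]
      nlinarith
    have hT0 : ∀ i x, 0 ≤ T i x := fun i x => by positivity
    intro i x
    rcases le_total (h (flip x i)) (h x) with hx | hx
    · linarith [main i x hx, hT0 i (flip x i)]
    · have := main i (flip x i) (by rwa [flip_flip])
      rw [flip_flip] at this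
      linarith [hT0 i x]
  calc _ ≤ ∑ i, expect (fun x => T i x + T i (flip x i)) :=
        Finset.sum_le_sum fun i _ => expect_mono (hpt i)
    _ = expect fun x => 2 * t ^ 2 * (Real.exp (t * h x) * ∑ i, max (partialD h i x) 0 ^ 2) := by
        simp only [expect_add, expect_comp_flip]
        rw [Finset.sum_add_distrib, ← two_mul, ← expect_sum, ← expect_const_mul]
        congr 1
        ext x
        simp only [hT, ← Finset.mul_sum]
        ring
    _ ≤ expect fun x => 2 * t ^ 2 * Real.exp (t * h x) := by
        refine expect_mono fun x => ?_
        have := mul_le_mul_of_nonneg_left (hgrad x) (Real.exp_pos (t * h x)).le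
        rw [mul_one] at this
        gcongr
    _ = _ := expect_const_mul _ _

theorem hasDerivAt_expect_exp (h : Cube n → ℝ) (t : ℝ) :
    HasDerivAt (fun t => expect fun x => Real.exp (t * h x))
      (expect fun x => Real.exp (t * h x) * h x) t := by
  simp only [expect, smul_eq_mul]
  refine HasDerivAt.const_mul _ (HasDerivAt.fun_sum fun x _ => ?_)
  simpa using ((hasDerivAt_id t).mul_const (h x)).exp

/-- Herbst's argument: the Laplace transform of a function with bounded one-sided gradient. -/
theorem expect_exp_le {h : Cube n → ℝ} (hgrad : ∀ x, ∑ i, max (partialD h i x) 0 ^ 2 ≤ 1)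
    {t : ℝ} (ht : 0 ≤ t) :
    expect (fun x => Real.exp (t * h x)) ≤ Real.exp (t * expect h + 2 * t ^ 2) := by
  set F : ℝ → ℝ := fun t => expect fun x => Real.exp (t * h x) with hF
  have hFpos : ∀ t, 0 < F t := fun t => expect_pos fun x => Real.exp_pos _
  have hF0 : F 0 = 1 := by simp [hF, expect_const]
  have hlog : ∀ t, HasDerivAt (fun t => Real.log (F t))
      ((expect fun x => Real.exp (t * h x) * h x) / F t) t := fun t =>
    (hasDerivAt_expect_exp h t).log (hFpos t).ne'
  have hder : ∀ s ∈ Set.Ioi (0 : ℝ), ∃ d,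
      HasDerivAt (fun t => t⁻¹ * Real.log (F t) - 2 * t) d s ∧ d ≤ 0 := by
    intro s hs
    have hs0 : 0 < s := hs
    refine ⟨_, ((hasDerivAt_inv hs0.ne').mul (hlog s)).sub ((hasDerivAt_id s).const_mul 2), ?_⟩
    have hent := entropy_exp_le hgrad hs0.le
    have e : (expect fun x => Real.exp (s * h x) * (s * h x)) =
        s * expect fun x => Real.exp (s * h x) * h x := by
      rw [← expect_const_mul]
      congr 1
      ext x
      ring
    rw [e] at hent
    change _ - F s * Real.log (F s) ≤ 2 * s ^ 2 * F s at hent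
    have hFs := hFpos s
    set D := expect fun x => Real.exp (s * h x) * h x
    have e2 : -(s ^ 2)⁻¹ * Real.log (F s) + s⁻¹ * (D / F s) - 2 * 1 =
        (s * D - F s * Real.log (F s) - 2 * s ^ 2 * F s) / (s ^ 2 * F s) := by
      field_simp
      ring
    rw [e2]
    exact div_nonpos_of_nonpos_of_nonneg (by linarith) (by positivity)
  have hanti : AntitoneOn (fun t => t⁻¹ * Real.log (F t) - 2 * t) (Set.Ioi 0) := by
    refine antitoneOn_of_deriv_nonpos (convex_Ioi 0) ?_ ?_ ?_
    · intro s hs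
      obtain ⟨d, hd, -⟩ := hder s hs
      exact hd.continuousAt.continuousWithinAt
    · rw [interior_Ioi]
      intro s hs
      obtain ⟨d, hd, -⟩ := hder s hs
      exact hd.differentiableAt.differentiableWithinAt
    · rw [interior_Ioi]
      intro s hs
      obtain ⟨d, hd, hle⟩ := hder s hs
      rwa [hd.deriv]
  -- Since `F 0 = 1`, the limit is the derivative of `log F` at `0`, which is `expect h`.
  have hlim : Filter.Tendsto (fun t => t⁻¹ * Real.log (F t) - 2 * t) (nhdsWithin 0 (Set.Ioi 0))
      (nhds (expect h)) := by
    have h1 := (hlog 0).tendsto_slope_zero_right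
    have h2 : Filter.Tendsto (fun t : ℝ => 2 * t) (nhdsWithin 0 (Set.Ioi 0)) (nhds 0) := by
      have : Continuous fun t : ℝ => 2 * t := by fun_prop
      simpa using (this.tendsto 0).mono_left nhdsWithin_le_nhds
    simpa [hF0] using h1.sub h2
  rcases ht.eq_or_lt with rfl | htpos
  · change F 0 ≤ _
    simp [hF0]
  · have hle : t⁻¹ * Real.log (F t) - 2 * t ≤ expect h := by
      refine ge_of_tendsto hlim ?_
      filter_upwards [Ioo_mem_nhdsGT htpos] with s hs
      exact hanti hs.1 htpos hs.2.le
    change F t ≤ _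
    rw [← Real.log_le_iff_le_exp (hFpos t)]
    have := mul_le_mul_of_nonneg_left hle ht
    rw [mul_sub, mul_inv_cancel_left₀ htpos.ne'] at this
    linarith

end Entropy

/-! ### From Laplace transform to Gaussian moment -/

section Gaussian

variable {n : ℕ}

theorem integral_exp_mul_sub (z b : ℝ) (hb : 0 < b) :
    ∫ t : ℝ, Real.exp (t * z) * Real.exp (-b * t ^ 2) =
      Real.exp (1 / (4 * b) * z ^ 2) * √(Real.pi / b) := by
  have e : ∀ t : ℝ, Real.exp (t * z) * Real.exp (-b * t ^ 2) =
      Real.exp (1 / (4 * b) * z ^ 2) * Real.exp (-b * (t - z / (2 * b)) ^ 2) := by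
    intro t
    rw [← Real.exp_add, ← Real.exp_add]
    congr 1
    field_simp
    ring
  simp only [e]
  rw [MeasureTheory.integral_const_mul,
    MeasureTheory.integral_sub_right_eq_self (fun t => Real.exp (-b * t ^ 2)), integral_gaussian]

theorem integrable_exp_mul_sub (z b : ℝ) (hb : 0 < b) :
    MeasureTheory.Integrable fun t : ℝ => Real.exp (t * z) * Real.exp (-b * t ^ 2) := by
  have e : ∀ t : ℝ, Real.exp (t * z) * Real.exp (-b * t ^ 2) =
      Real.exp (1 / (4 * b) * z ^ 2) * Real.exp (-b * (t - z / (2 * b)) ^ 2) := by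
    intro t
    rw [← Real.exp_add, ← Real.exp_add]
    congr 1
    field_simp
    ring
  simp only [e]
  exact ((integrable_exp_neg_mul_sq hb).comp_sub_right _).const_mul _

/-- Integration of a bound for the Laplace transform against a Gaussian density. -/
theorem expect_exp_sq_le {Z : Cube n → ℝ} (hZ : ∀ x, 0 ≤ Z x) {M : ℝ}
    (h : ∀ t, 0 ≤ t → expect (fun x => Real.exp (t * Z x)) ≤ Real.exp (t * M + 2 * t ^ 2)) :
    expect (fun x => Real.exp (1 / (4 * Real.exp 1) * Z x ^ 2)) ≤
      Real.exp (1 + 5 / 4 * M ^ 2) := by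
  have he : 2.7 < Real.exp 1 := by linarith [Real.exp_one_gt_d9]
  set b := Real.exp 1 with hb
  have hb0 : 0 < b := by linarith
  have hc0 : 0 < b - 11 / 5 := by linarith
  -- Young's inequality `|t| M ≤ t²/5 + 5M²/4`, so that `2 + 1/5 = 11/5` is still below `b = e`. For
  -- negative `t`, `Z ≥ 0` allows replacing `t` by `|t|`.
  have hpt : ∀ t : ℝ, (expect fun x => Real.exp (t * Z x) * Real.exp (-b * t ^ 2)) ≤
      Real.exp (5 / 4 * M ^ 2) * Real.exp (-(b - 11 / 5) * t ^ 2) := by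
    intro t
    have h1 : expect (fun x => Real.exp (t * Z x)) ≤ Real.exp (|t| * M + 2 * t ^ 2) := by
      have := h |t| (abs_nonneg t)
      rw [sq_abs] at this
      refine (expect_mono fun x => ?_).trans this
      have := mul_le_mul_of_nonneg_right (le_abs_self t) (hZ x)
      exact Real.exp_le_exp.2 this
    have h2 : (expect fun x => Real.exp (t * Z x) * Real.exp (-b * t ^ 2)) =
        Real.exp (-b * t ^ 2) * expect fun x => Real.exp (t * Z x) := by
      simp only [mul_comm _ (Real.exp (-b * t ^ 2)), expect_const_mul]
    rw [h2, ← Real.exp_add]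
    refine (mul_le_mul_of_nonneg_left h1 (Real.exp_pos _).le).trans ?_
    rw [← Real.exp_add]
    refine Real.exp_le_exp.2 ?_
    nlinarith [sq_nonneg (|t| - 5 / 2 * M), sq_abs t]
  have hint : ∫ t : ℝ, (expect fun x => Real.exp (t * Z x) * Real.exp (-b * t ^ 2)) =
      (expect fun x => Real.exp (1 / (4 * b) * Z x ^ 2)) * √(Real.pi / b) := by
    simp only [expect, smul_eq_mul]
    rw [MeasureTheory.integral_const_mul, MeasureTheory.integral_finsetSum]
    · simp only [integral_exp_mul_sub _ b hb0, ← Finset.sum_mul]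
      ring
    · exact fun x _ => integrable_exp_mul_sub _ b hb0
  have hmono := MeasureTheory.integral_mono (μ := MeasureTheory.volume)
    (by simp only [expect, smul_eq_mul]
        exact (MeasureTheory.integrable_finsetSum _
          fun x _ => integrable_exp_mul_sub _ b hb0).const_mul _)
    ((integrable_exp_neg_mul_sq hc0).const_mul _) hpt
  rw [hint, MeasureTheory.integral_const_mul, integral_gaussian] at hmono
  -- Amounts to `b (b - 11/5) ≥ 1`; the factor `b = e` becomes the summand `1` in the final
  -- exponent.
  have hratio : √(Real.pi / (b - 11 / 5)) ≤ b * √(Real.pi / b) := by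
    refine Real.sqrt_le_iff.2 ⟨by positivity, ?_⟩
    rw [mul_pow, Real.sq_sqrt (by positivity), div_le_iff₀ hc0]
    have : b ^ 2 * (Real.pi / b) * (b - 11 / 5) = Real.pi * (b * (b - 11 / 5)) := by
      field_simp
    rw [this]
    exact le_mul_of_one_le_right Real.pi_pos.le (by nlinarith)
  have hpos : 0 < √(Real.pi / b) := by positivity
  refine le_of_mul_le_mul_right (hmono.trans ?_) hpos
  rw [Real.exp_add, ← hb, mul_comm b, mul_assoc]
  gcongr

end Gaussian

/-! ### Gradient of the deviation, bound for its mean, conclusion -/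

section Main

variable {E : Type*} [NormedAddCommGroup E] [NormedSpace ℝ E] {n : ℕ}

theorem lazyWalk_one_sq (l : List ℝ) (a : ℝ) :
    lazyWalk 1 l (fun b => b ^ 2) a = a ^ 2 + (l.map fun v => v ^ 2).sum := by
  induction l generalizing a with
  | nil => simp
  | cons v l ih =>
    simp only [lazyWalk_cons, lazyStep, ih, List.map_cons, List.sum_cons]
    ring

theorem expect_sq_rademacher (a : Fin n → ℝ) :
    expect (fun δ : Cube n => (∑ i, coord δ i * a i) ^ 2) = ∑ i, a i ^ 2 := by
  have := expect_rademacher a (fun b => b ^ 2) 0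
  simpa [lazyWalk_one_sq, List.sum_ofFn, Function.comp_def] using this

theorem gradSq_eq_lazyWalk (f : Cube n → E) (x : Cube n) :
    gradSq f x = lazyWalk 1 (List.ofFn fun i => partialD f i x) (fun b => ‖b‖ ^ 2) 0 := by
  rw [← expect_rademacher]
  simp [gradSq]

/-- The one-sided gradient of the distance to a point. -/
theorem sum_posPart_partialD_norm_le (f : Cube n → E) (m : E) (x : Cube n) :
    ∑ i, max (partialD (fun y => ‖f y - m‖) i x) 0 ^ 2 ≤ gradSq f x := by
  obtain ⟨ξ, hξ1, hξ⟩ := exists_dual_vector'' ℝ (f x - m)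
  have hle : ∀ w, ξ w ≤ ‖w‖ := fun w =>
    (le_abs_self _).trans ((ξ.le_of_opNorm_le hξ1 w).trans_eq (one_mul _))
  calc _ ≤ ∑ i, ξ (partialD f i x) ^ 2 := by
        refine Finset.sum_le_sum fun i _ => ?_
        -- `ξ` norms `f x - m` and only underestimates the norm at the neighbour; hence just an
        -- upper bound, but with the same `ξ` for all `i`.
        have h1 : partialD (fun y => ‖f y - m‖) i x ≤ ξ (partialD f i x) := by
          have h2 := hle (f (flip x i) - m)
          have h3 : ξ (f x - m) = ‖f x - m‖ := hξ
          simp only [partialD, smul_eq_mul, map_smul, map_sub] at h2 h3 ⊢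
          linarith
        rcases le_total (partialD (fun y => ‖f y - m‖) i x) 0 with h | h
        · rw [max_eq_right h, zero_pow two_ne_zero]
          exact sq_nonneg _
        · rw [max_eq_left h]
          exact pow_le_pow_left₀ h h1 2
    _ = expect fun δ : Cube n => (∑ i, coord δ i * ξ (partialD f i x)) ^ 2 :=
        (expect_sq_rademacher _).symm
    _ ≤ gradSq f x := by
        refine expect_mono fun δ => ?_
        have e : ∑ i, coord δ i * ξ (partialD f i x) = ξ (∑ i, coord δ i • partialD f i x) := by
          simp [map_sum]
        rw [e, ← sq_abs]
        exact pow_le_pow_left₀ (abs_nonneg _)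
          ((ξ.le_of_opNorm_le hξ1 _).trans_eq (one_mul _)) 2

theorem IsCotypeBound.expect_norm_sub_le [Nontrivial E] {Q C : ℝ} (hC : IsCotypeBound E Q C)
    (hQ : 2 ≤ Q) {f : Cube n → E} (hf : ∀ x, gradSq f x ≤ 1) :
    expect (fun x => ‖f x - expect f‖) ≤ 32 * C * Q := by
  have hC1 := hC.one_le
  -- Hypercontractivity needs an even integer exponent; `Q ≥ 2` gives `2q ≤ Q + 2 ≤ 2Q`, so `2 · 8C
  -- · 2q ≤ 32 C Q`.
  set q : ℕ := ⌈Q / 2⌉₊ with hq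
  have h1 : Q ≤ ((2 * q : ℕ) : ℝ) := by
    have := Nat.le_ceil (Q / 2)
    push_cast
    linarith
  have h2 : ((2 * q : ℕ) : ℝ) ≤ 2 * Q := by
    have := Nat.ceil_lt_add_one (by positivity : 0 ≤ Q / 2)
    push_cast
    linarith
  have h0 : 0 < ((2 * q : ℕ) : ℝ) := by linarith
  refine (expect_norm_sub_expect_le (K := 8 * C) (α := 1 / ((2 * q : ℕ) : ℝ)) (by positivity)
    (by positivity) ((div_le_one h0).2 (by linarith)) fun z p hp hp1 =>
      hC.lazyWalk_norm_le (by linarith) hC1 h1 (gradSq_eq_lazyWalk f z ▸ hf z) hp hp1).trans ?_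
  rw [div_div_eq_mul_div, div_one]
  nlinarith

end Main

end HammingCube

end

theorem mainTheorem1 :
    ∃ c₀ : ℝ, 0 < c₀ ∧
      ∀ (E : Type*) [NormedAddCommGroup E] [NormedSpace ℝ E] [CompleteSpace E]
        (Q : ℝ), HammingCube.HasCotype E Q →
      ∀ (n : ℕ) (f : HammingCube.Cube n → E),
        (∀ x, HammingCube.gradSq f x ≤ 1) →
        HammingCube.expect (fun x =>
            Real.exp (1 / (4 * Real.exp 1) * ‖f x - HammingCube.expect f‖ ^ 2)) ≤
          Real.exp (c₀ * HammingCube.cotypeConst E Q ^ 2 * Q ^ 2) := by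
  -- With `M = 32 C Q`, `1 + (5/4) M² = 1 + 1280 C²Q² ≤ 1281 C²Q²`, because `C Q ≥ 1`.
  refine ⟨1281, by norm_num, ?_⟩
  intro E _ _ _ Q hQ n f hf
  have hC := HammingCube.isCotypeBound_cotypeConst E Q hQ
  have hQ2 := hQ.1
  set C := HammingCube.cotypeConst E Q
  -- In the zero space the cotype constant is `0`, so `1 ≤ C` fails, but the deviation vanishes.
  rcases subsingleton_or_nontrivial E with hE | hE
  · have : ∀ x, f x - HammingCube.expect f = 0 := fun x => Subsingleton.elim _ _
    simp only [this, norm_zero, ne_eq, OfNat.ofNat_ne_zero, not_false_eq_true, zero_pow, mul_zero,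
      Real.exp_zero, HammingCube.expect_const]
    exact Real.one_le_exp (by positivity)
  · have hC1 := hC.one_le
    have hM := hC.expect_norm_sub_le hQ2 hf
    refine (HammingCube.expect_exp_sq_le (fun x => norm_nonneg _) (M := 32 * C * Q)
      fun t ht => ?_).trans (Real.exp_le_exp.2 ?_)
    · refine (HammingCube.expect_exp_le (fun x =>
        (HammingCube.sum_posPart_partialD_norm_le f _ x).trans (hf x)) ht).trans ?_
      gcongr
    · have : 1 ≤ C * Q := by nlinarith
      nlinarith
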